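/- Let $F_n$ be the free group of finite rank $n$, let $M$ be a finite subgroup of $\mathrm{Aut}(F_n)$, and let $G = F_n \rtimes M$ be the split extension (semidirect product) in which $M$ acts on $F_n$ in the natural way. Then $G$ is finitely generated and the conjugacy problem is solvable for $G$: for every finite generating family $g_1,\dots,g_k$ of $G$ there is an algorithm which, given any two words in the letters $g_1^{\pm1},\dots,g_k^{\pm1}$, decides whether the elements of $G$ that they represent are conjugate in $G$. -/

import Mathlib

/-- The element of the group `G` that a word in the letters `g i` and `(g i)⁻¹` represents.
A letter is a pair `(i, b)`: it stands for `g i` if `b = true` and for `(g i)⁻¹` if `b = false`. -/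
def wordValue {G : Type*} [Group G] {k : ℕ} (g : Fin k → G) (w : List (Fin k × Bool)) : G :=
  (w.map fun x => if x.2 then g x.1 else (g x.1)⁻¹).prod

/-- The conjugacy problem for the generators `g` of `G` is decidable: there is an algorithm (a
computable function) that, given any two words in the generators and their inverses, decides
whether the elements of `G` that they represent are conjugate in `G`. -/
def DecidesConjugacy {G : Type*} [Group G] {k : ℕ} (g : Fin k → G) : Prop :=
  ComputablePred fun p : List (Fin k × Bool) × List (Fin k × Bool) =>
    IsConj (wordValue g p.1) (wordValue g p.2)

/-- Dehn's conjugacy problem is solvable for `G`: the group `G` is finitely generated, and for every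
finite generating family the conjugacy of two given words in it is algorithmically decidable. -/
def ConjugacyProblemSolvable (G : Type*) [Group G] : Prop :=
  Group.FG G ∧
    ∀ (k : ℕ) (g : Fin k → G), Subgroup.closure (Set.range g) = ⊤ → DecidesConjugacy g

/-!
A free group `F` acts on its Cayley tree by isometries, and a finite group `H` of automorphisms acts
by quasi-isometries, for which by bounded cancellation distances still add up along geodesics, up to
a constant. Hence, in the `H`-invariant metric that sums the tree distance over `H`, the
displacement of an element `v` of `F ⋊ H` is quasiconvex along geodesics. If `f ∈ F` conjugates `u`
to `v`, then `v` has small displacement at `1` and at `f` (there it is the displacement of `u` at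
`1`), so all conjugates of `v` by the vertices of the geodesic from `1` to `f` lie in a ball whose
radius is linear in the lengths of `u` and `v`. For a shortest `f` these conjugates are distinct, so
the length of `f` is bounded by the number of elements of the ball, which is exponential in the
radius. It remains to test the finitely many words up to this length with the solution of the word
problem.
-/

open FreeGroup (mk)
open SemidirectProduct (inl inr)

section Tree

theorem isReduced_invRev_append {α : Type*} {X Y : List (α × Bool)}
    (hX : FreeGroup.IsReduced X) (hY : FreeGroup.IsReduced Y) (h : ∀ l ∈ X.head?, l ∉ Y.head?) :
    FreeGroup.IsReduced (FreeGroup.invRev X ++ Y) := by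
  classical
  have hX_inv : FreeGroup.IsReduced (FreeGroup.invRev X) := by
    rw [FreeGroup.isReduced_iff_reduce_eq, FreeGroup.reduce_invRev, hX.reduce_eq]
  refine List.isChain_append.2 ⟨hX_inv, hY, ?_⟩
  rintro a ha b hb hab
  obtain ⟨c, hc, rfl⟩ : ∃ c ∈ X.head?, (c.1, !c.2) = a := by
    simpa [FreeGroup.invRev] using ha
  by_contra hne
  have hcb : c = b := Prod.ext hab (by simpa [eq_comm] using hne)
  exact h c hc (hcb ▸ hb)

variable {α β : Type*} [DecidableEq α] [DecidableEq β] {x y z : FreeGroup α}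

/-- The distance in the Cayley tree of a free group, that is, the word metric of its basis. -/
def treeDist (x y : FreeGroup α) : ℕ :=
  (x⁻¹ * y).norm

theorem treeDist_self (x : FreeGroup α) : treeDist x x = 0 := by
  simp [treeDist]

theorem treeDist_comm (x y : FreeGroup α) : treeDist x y = treeDist y x := by
  rw [treeDist, treeDist, ← FreeGroup.norm_inv_eq, mul_inv_rev, inv_inv]

theorem treeDist_triangle (x y z : FreeGroup α) :
    treeDist x z ≤ treeDist x y + treeDist y z := by
  simpa [treeDist, mul_assoc] using FreeGroup.norm_mul_le (x⁻¹ * y) (y⁻¹ * z)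

theorem treeDist_mul_left (a x y : FreeGroup α) : treeDist (a * x) (a * y) = treeDist x y := by
  simp [treeDist, mul_assoc]

theorem treeDist_one_left (x : FreeGroup α) : treeDist 1 x = x.norm := by
  simp [treeDist]

theorem treeDist_mul_mk_singleton_le (x : FreeGroup α) (l : α × Bool) :
    treeDist x (x * mk [l]) ≤ 1 := by
  simpa [treeDist] using FreeGroup.norm_mk_le (L₁ := [l])

/-- The vertex `z` lies on the geodesic from `x` to `y` in the Cayley tree. -/
def Between (x z y : FreeGroup α) : Prop :=
  treeDist x z + treeDist z y = treeDist x y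

theorem Between.symm (h : Between x z y) : Between y z x := by
  rw [Between] at h ⊢
  rw [treeDist_comm y z, treeDist_comm z x, treeDist_comm y x, add_comm, h]

/-- The label of the first edge of the geodesic from `z` to `x` in the Cayley tree; it is `none`
if `z = x`. -/
def direction (z x : FreeGroup α) : Option (α × Bool) :=
  (z⁻¹ * x).toWord.head?

theorem treeDist_mul_mk_of_mem_direction {l : α × Bool} (h : l ∈ direction z x) :
    treeDist (z * mk [l]) x + 1 = treeDist z x := by
  obtain ⟨X, hX⟩ := List.head?_eq_some_iff.1 h
  have hX_reduced : FreeGroup.IsReduced X :=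
    (hX ▸ FreeGroup.isReduced_toWord : FreeGroup.IsReduced (l :: X)).tail
  have hx : z⁻¹ * x = mk [l] * mk X := by
    rw [FreeGroup.mul_mk, List.singleton_append, ← hX, FreeGroup.mk_toWord]
  have hrest : (z * mk [l])⁻¹ * x = mk X := by
    rw [mul_inv_rev, mul_assoc, hx, inv_mul_cancel_left]
  rw [treeDist, treeDist, hrest, FreeGroup.norm, FreeGroup.norm, hX, FreeGroup.toWord_mk,
    hX_reduced.reduce_eq, List.length_cons]

theorem between_iff_direction :
    Between x z y ↔ ∀ l ∈ direction z x, l ∉ direction z y := by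
  constructor
  · intro h l hx hy
    have hx' := treeDist_mul_mk_of_mem_direction hx
    have hy' := treeDist_mul_mk_of_mem_direction hy
    have htri := treeDist_triangle x (z * mk [l]) y
    rw [Between, treeDist_comm x z] at h
    rw [treeDist_comm x (z * mk [l])] at htri
    lia
  · intro h
    have hred := isReduced_invRev_append FreeGroup.isReduced_toWord FreeGroup.isReduced_toWord h
    have hxy : mk (FreeGroup.invRev (z⁻¹ * x).toWord ++ (z⁻¹ * y).toWord) = x⁻¹ * y := by
      rw [← FreeGroup.mul_mk, ← FreeGroup.inv_mk, FreeGroup.mk_toWord, FreeGroup.mk_toWord]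
      group
    rw [Between, treeDist_comm x z, treeDist, treeDist, treeDist, FreeGroup.norm, FreeGroup.norm,
      FreeGroup.norm, ← hxy, FreeGroup.toWord_mk, hred.reduce_eq, List.length_append,
      FreeGroup.invRev_length]

theorem Between.or (h : Between x z y) (w : FreeGroup α) : Between x z w ∨ Between y z w := by
  simp only [between_iff_direction] at *
  by_contra! hc
  obtain ⟨⟨l, hlx, hlw⟩, l', hly, hlw'⟩ := hc
  obtain rfl : l = l' := Option.mem_unique hlw hlw'
  exact h l hlx hly

theorem exists_closer_of_ne (h : x ≠ y) :
    ∃ x', treeDist x x' ≤ 1 ∧ treeDist x' y + 1 = treeDist x y := by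
  obtain ⟨l, hl⟩ : ∃ l, l ∈ direction x y := by
    refine Option.isSome_iff_exists.1 (List.isSome_head?.2 ?_)
    rwa [Ne, FreeGroup.toWord_eq_nil_iff, inv_mul_eq_one]
  exact ⟨x * mk [l], treeDist_mul_mk_singleton_le x l, treeDist_mul_mk_of_mem_direction hl⟩

/-- A vertex with minimal sum of distances to `x`, `y` and `z` is a median: if two of the three
geodesics out of it had the same first edge, then moving along this edge would decrease the sum. -/
theorem exists_median (x y z : FreeGroup α) :
    ∃ p, Between x p y ∧ Between y p z ∧ Between x p z := by
  let cost (p : FreeGroup α) : ℕ := treeDist p x + treeDist p y + treeDist p z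
  let p := Function.argmin cost
  have hmin (q : FreeGroup α) : cost p ≤ cost q := Function.argmin_le cost q
  have hbetween {a b c : FreeGroup α}
      (hcost : ∀ q, treeDist q a + treeDist q b + treeDist q c = cost q) : Between a p b := by
    refine between_iff_direction.2 fun l ha hb => ?_
    have ha' := treeDist_mul_mk_of_mem_direction ha
    have hb' := treeDist_mul_mk_of_mem_direction hb
    have hc := treeDist_triangle (p * mk [l]) p c
    have hstep := treeDist_mul_mk_singleton_le p l
    have hle := hmin (p * mk [l])
    rw [treeDist_comm] at hstep
    rw [← hcost, ← hcost] at hle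
    lia
  exact ⟨p, hbetween (c := z) fun _ => rfl, hbetween (c := x) fun q => by simp only [cost]; ring,
    hbetween (c := y) fun q => by simp only [cost]; ring⟩

variable {g : FreeGroup α → FreeGroup β} {K L : ℕ}

theorem exists_between_treeDist_map_le
    (hK : ∀ x y, treeDist (g x) (g y) ≤ K * treeDist x y) {p : FreeGroup β}
    (hp : Between (g x) p (g y)) : ∃ q, Between x q y ∧ treeDist (g q) p ≤ K := by
  induction hd : treeDist x y using Nat.strong_induction_on generalizing x with
  | _ d ih =>
    by_cases hxy : x = y
    · subst hxy
      refine ⟨x, by simp [Between, treeDist_self], ?_⟩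
      rw [Between, treeDist_self] at hp
      lia
    · obtain ⟨x', hxx', hx'y⟩ := exists_closer_of_ne hxy
      have hgxx' : treeDist (g x) (g x') ≤ K :=
        (hK x x').trans (mul_le_of_le_one_right (Nat.zero_le K) hxx')
      obtain hnear | hfar := hp.or (g x')
      · refine ⟨x, by simp [Between, treeDist_self], ?_⟩
        rw [Between] at hnear
        lia
      · obtain ⟨q, hq, hgq⟩ := ih _ (by lia) hfar.symm rfl
        refine ⟨q, ?_, hgq⟩
        have htri := treeDist_triangle x x' q
        have htri' := treeDist_triangle x q y
        rw [Between] at hq ⊢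
        lia

/-- Cooper's bounded cancellation lemma, for bi-Lipschitz maps. The image of the geodesic from `x`
to `y` passes close to the median `p` of the images once before `z` and once after it; these two
points are close to each other, so `z`, which lies between them, is mapped close to `p` as well. -/
theorem bounded_cancellation (hK : ∀ x y, treeDist (g x) (g y) ≤ K * treeDist x y)
    (hL : ∀ x y, treeDist x y ≤ L * treeDist (g x) (g y)) (h : Between x z y) :
    treeDist (g x) (g z) + treeDist (g z) (g y) ≤
      treeDist (g x) (g y) + 2 * (K + K * (L * (2 * K))) := by
  obtain ⟨p, hxz, hzy, hxy⟩ := exists_median (g x) (g z) (g y)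
  obtain ⟨q, hq, hqp⟩ := exists_between_treeDist_map_le hK hxz
  obtain ⟨r, hr, hrp⟩ := exists_between_treeDist_map_le hK hzy
  have hqr : treeDist q r ≤ L * (2 * K) := by
    refine (hL q r).trans (Nat.mul_le_mul_left L ?_)
    have := treeDist_triangle (g q) p (g r)
    rw [treeDist_comm p] at this
    lia
  have hqz : treeDist q z ≤ treeDist q r := by
    have h₁ := treeDist_triangle x q y
    have h₂ := treeDist_triangle q r y
    rw [Between] at h hq hr
    lia
  have hzp : treeDist (g z) p ≤ K + K * (L * (2 * K)) := by
    have h₁ := treeDist_triangle (g z) (g q) p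
    have h₂ := (hK q z).trans (Nat.mul_le_mul_left K (hqz.trans hqr))
    rw [treeDist_comm (g z) (g q)] at h₁
    lia
  rw [Between] at hxz hzy hxy
  rw [treeDist_comm p (g z)] at hxz
  lia

end Tree

section WordLength

variable {G : Type*} [Group G]

theorem map_mk_cons {α : Type*} (f : FreeGroup α →* G) (c : α × Bool) (w : List (α × Bool)) :
    f (mk (c :: w)) = f (mk [c]) * f (mk w) := by
  rw [← map_mul, FreeGroup.mul_mk, List.singleton_append]

theorem exists_length_map_mk_le {α : Type*} [Finite α] (f : FreeGroup α →* G) {ℓ : G → ℕ}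
    (ℓ_one : ℓ 1 = 0) (ℓ_mul : ∀ a b, ℓ (a * b) ≤ ℓ a + ℓ b) :
    ∃ K, ∀ w, ℓ (f (mk w)) ≤ K * w.length := by
  obtain ⟨K, hK⟩ := (Set.finite_range fun c : α × Bool => ℓ (f (mk [c]))).bddAbove
  refine ⟨K, fun w => ?_⟩
  induction w with
  | nil => rw [← FreeGroup.one_eq_mk, map_one, ℓ_one, List.length_nil, mul_zero]
  | cons c w ih =>
    calc ℓ (f (mk (c :: w))) ≤ ℓ (f (mk [c])) + ℓ (f (mk w)) := by
          rw [map_mk_cons]; exact ℓ_mul _ _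
      _ ≤ K + K * w.length := add_le_add (hK ⟨c, rfl⟩) ih
      _ = K * (c :: w).length := by rw [List.length_cons]; ring

theorem exists_length_map_le {α : Type*} [DecidableEq α] [Finite α] (f : FreeGroup α →* G)
    {ℓ : G → ℕ} (ℓ_one : ℓ 1 = 0) (ℓ_mul : ∀ a b, ℓ (a * b) ≤ ℓ a + ℓ b) :
    ∃ K, ∀ x, ℓ (f x) ≤ K * x.norm := by
  obtain ⟨K, hK⟩ := exists_length_map_mk_le f ℓ_one ℓ_mul
  exact ⟨K, fun x => by simpa only [FreeGroup.mk_toWord, FreeGroup.norm] using hK x.toWord⟩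

variable {k : ℕ} {g : Fin k → G}

theorem lift_mk_eq_wordValue (g : Fin k → G) (w : List (Fin k × Bool)) :
    FreeGroup.lift g (mk w) = wordValue g w := by
  rw [FreeGroup.lift_mk, wordValue]
  exact congrArg List.prod (List.map_congr_left fun c _ => by cases c.2 <;> rfl)

theorem wordValue_append (g : Fin k → G) (w w' : List (Fin k × Bool)) :
    wordValue g (w ++ w') = wordValue g w * wordValue g w' := by
  simp only [wordValue, List.map_append, List.prod_append]

theorem exists_wordValue_eq (hg : Subgroup.closure (Set.range g) = ⊤) (x : G) :
    ∃ w, wordValue g w = x := by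
  have hx : x ∈ (FreeGroup.lift g).range := by
    rw [FreeGroup.range_lift_eq_closure, hg]
    exact Subgroup.mem_top x
  obtain ⟨y, rfl⟩ := hx
  exact ⟨y.toWord, by rw [← lift_mk_eq_wordValue, FreeGroup.mk_toWord]⟩

/-- The length of a shortest word in the letters `g i` and `(g i)⁻¹` that represents `x`; it is `0`
if there is no such word. -/
noncomputable def wordLength (g : Fin k → G) (x : G) : ℕ :=
  sInf (List.length '' {w | wordValue g w = x})

theorem wordLength_wordValue_le (g : Fin k → G) (w : List (Fin k × Bool)) :
    wordLength g (wordValue g w) ≤ w.length :=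
  Nat.sInf_le ⟨w, rfl, rfl⟩

theorem exists_length_eq_wordLength (hg : Subgroup.closure (Set.range g) = ⊤) (x : G) :
    ∃ w, wordValue g w = x ∧ w.length = wordLength g x := by
  obtain ⟨w, hw⟩ := exists_wordValue_eq hg x
  exact Nat.sInf_mem (Set.Nonempty.image List.length ⟨w, hw⟩)

theorem wordLength_one (g : Fin k → G) : wordLength g 1 = 0 :=
  Nat.le_zero.1 (wordLength_wordValue_le g [])

theorem wordLength_mul_le (hg : Subgroup.closure (Set.range g) = ⊤) (x y : G) :
    wordLength g (x * y) ≤ wordLength g x + wordLength g y := by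
  obtain ⟨v, rfl, hv⟩ := exists_length_eq_wordLength hg x
  obtain ⟨w, rfl, hw⟩ := exists_length_eq_wordLength hg y
  rw [← wordValue_append, ← hv, ← hw, ← List.length_append]
  exact wordLength_wordValue_le g _

/-- The function `b` is an upper bound of the conjugator length function of `G`: whenever two words
represent conjugate elements, a word of length at most `b l` represents a conjugator, where `l` is
the sum of the lengths of the two words. -/
def IsConjugatorLengthBound (g : Fin k → G) (b : ℕ → ℕ) : Prop :=
  ∀ w w', IsConj (wordValue g w) (wordValue g w') → ∃ x, x.length ≤ b (w.length + w'.length) ∧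
    SemiconjBy (wordValue g x) (wordValue g w) (wordValue g w')

end WordLength

/-- The action of a semidirect product `N ⋊[φ] H` on `N`, in which `N` acts by left multiplication
and `H` through `φ`. -/
instance semidirectMulAction {N H : Type*} [Group N] [Group H] (φ : H →* MulAut N) :
    MulAction (N ⋊[φ] H) N where
  smul u x := u.left * φ u.right x
  one_smul x := by change 1 * φ 1 x = x; simp
  mul_smul u v x := by
    change u.left * φ u.right v.left * φ (u.right * v.right) x =
      u.left * φ u.right (v.left * φ v.right x)
    simp [mul_assoc]

theorem semidirect_smul_def {N H : Type*} [Group N] [Group H] {φ : H →* MulAut N} (u : N ⋊[φ] H)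
    (x : N) : u • x = u.left * φ u.right x :=
  rfl

section Displacement

variable {α H : Type*} [DecidableEq α] [Group H]

theorem exists_treeDist_add_le [Finite α] (ψ : MulAut (FreeGroup α)) :
    ∃ C, ∀ x z y, Between x z y →
      treeDist (ψ x) (ψ z) + treeDist (ψ z) (ψ y) ≤ treeDist (ψ x) (ψ y) + C := by
  have exists_lipschitz (θ : MulAut (FreeGroup α)) :
      ∃ K, ∀ x y, treeDist (θ x) (θ y) ≤ K * treeDist x y := by
    obtain ⟨K, hK⟩ :=
      exists_length_map_le θ.toMonoidHom FreeGroup.norm_one FreeGroup.norm_mul_le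
    exact ⟨K, fun x y => by simpa [treeDist] using hK (x⁻¹ * y)⟩
  obtain ⟨K, hK⟩ := exists_lipschitz ψ
  obtain ⟨L, hL⟩ := exists_lipschitz ψ⁻¹
  exact ⟨_, fun x z y => bounded_cancellation hK fun a b => by simpa using hL (ψ a) (ψ b)⟩

variable [Fintype H] {φ : H →* MulAut (FreeGroup α)}

/-- The sum of the tree distances of the images of `x` and `y` under the automorphisms `φ t`. Unlike
the tree distance itself it is invariant under the action of `FreeGroup α ⋊[φ] H`. -/
def orbitDist (φ : H →* MulAut (FreeGroup α)) (x y : FreeGroup α) : ℕ :=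
  ∑ t, treeDist (φ t x) (φ t y)

theorem orbitDist_self (x : FreeGroup α) : orbitDist φ x x = 0 := by
  simp only [orbitDist, treeDist_self, Finset.sum_const_zero]

theorem orbitDist_triangle (x y z : FreeGroup α) :
    orbitDist φ x z ≤ orbitDist φ x y + orbitDist φ y z := by
  rw [orbitDist, orbitDist, orbitDist, ← Finset.sum_add_distrib]
  exact Finset.sum_le_sum fun t _ => treeDist_triangle _ _ _

theorem orbitDist_smul (u : FreeGroup α ⋊[φ] H) (x y : FreeGroup α) :
    orbitDist φ (u • x) (u • y) = orbitDist φ x y := by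
  refine Fintype.sum_equiv (Equiv.mulRight u.right) _ _ fun t => ?_
  simp only [semidirect_smul_def, map_mul, treeDist_mul_left, Equiv.coe_mulRight, MulAut.mul_apply]

theorem treeDist_le_orbitDist (x y : FreeGroup α) : treeDist x y ≤ orbitDist φ x y := by
  simpa [orbitDist] using Finset.single_le_sum (f := fun t => treeDist (φ t x) (φ t y))
    (fun _ _ => Nat.zero_le _) (Finset.mem_univ 1)

theorem exists_orbitDist_add_le [Finite α] (φ : H →* MulAut (FreeGroup α)) :
    ∃ C, ∀ x z y, Between x z y → orbitDist φ x z + orbitDist φ z y ≤ orbitDist φ x y + C := by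
  choose C hC using fun t => exists_treeDist_add_le (φ t)
  refine ⟨∑ t, C t, fun x z y h => ?_⟩
  rw [orbitDist, orbitDist, orbitDist, ← Finset.sum_add_distrib, ← Finset.sum_add_distrib]
  exact Finset.sum_le_sum fun t _ => hC t x z y h

/-- The displacement of an element that acts on a tree is quasiconvex: if `z` lies between `x` and
`y`, then it lies between one of them and its own image `u • z`. -/
theorem exists_displacement_le [Finite α] (φ : H →* MulAut (FreeGroup α)) :
    ∃ C, ∀ (u : FreeGroup α ⋊[φ] H) (x z y), Between x z y →
      orbitDist φ z (u • z) ≤ max (orbitDist φ x (u • x)) (orbitDist φ y (u • y)) + C := by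
  obtain ⟨C, hC⟩ := exists_orbitDist_add_le φ
  refine ⟨C, fun u x z y h => ?_⟩
  have displacement_le {a : FreeGroup α} (ha : Between a z (u • z)) :
      orbitDist φ z (u • z) ≤ orbitDist φ a (u • a) + C := by
    have hcancel := hC a z (u • z) ha
    have htri := orbitDist_triangle (φ := φ) a (u • a) (u • z)
    rw [orbitDist_smul] at htri
    lia
  obtain hx | hy := h.or (u • z)
  · exact (displacement_le hx).trans (Nat.add_le_add_right (le_max_left _ _) C)
  · exact (displacement_le hy).trans (Nat.add_le_add_right (le_max_right _ _) C)

theorem orbitDist_conj_smul (u v : FreeGroup α ⋊[φ] H) (x : FreeGroup α) :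
    orbitDist φ (v • x) ((v * u * v⁻¹) • v • x) = orbitDist φ x (u • x) := by
  rw [mul_smul, inv_smul_smul, mul_smul, orbitDist_smul]

theorem exists_displacement_wordValue_le {k : ℕ} (g : Fin k → FreeGroup α ⋊[φ] H) :
    ∃ K, ∀ w, orbitDist φ 1 (wordValue g w • 1) ≤ K * w.length := by
  obtain ⟨K, hK⟩ := exists_length_map_mk_le (FreeGroup.lift g)
    (ℓ := fun u => orbitDist φ 1 (u • 1)) (by rw [one_smul, orbitDist_self]) fun u v => by
      rw [mul_smul, ← orbitDist_smul u 1 (v • 1)]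
      exact orbitDist_triangle _ _ _
  exact ⟨K, fun w => by simpa only [lift_mk_eq_wordValue] using hK w⟩

end Displacement

section ShortestTranslation

variable {α : Type*} [DecidableEq α]

theorem norm_mk_take_le (f : FreeGroup α) (i : ℕ) : (mk (f.toWord.take i)).norm ≤ i :=
  FreeGroup.norm_mk_le.trans (List.length_take_le _ _)

theorem treeDist_mk_take_le (f : FreeGroup α) (i : ℕ) :
    treeDist (mk (f.toWord.take i)) f ≤ f.norm - i := by
  have hsplit : f = mk (f.toWord.take i) * mk (f.toWord.drop i) := by
    rw [FreeGroup.mul_mk, List.take_append_drop, FreeGroup.mk_toWord]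
  have hdrop : (mk (f.toWord.take i))⁻¹ * f = mk (f.toWord.drop i) := inv_mul_eq_of_eq_mul hsplit
  rw [treeDist, hdrop]
  exact FreeGroup.norm_mk_le.trans List.length_drop.le

theorem between_one_mk_take {f : FreeGroup α} {i : ℕ} (hi : i ≤ f.norm) :
    Between 1 (mk (f.toWord.take i)) f := by
  have htri := treeDist_triangle 1 (mk (f.toWord.take i)) f
  have htake := norm_mk_take_le f i
  have hdrop := treeDist_mk_take_le f i
  rw [Between]
  rw [treeDist_one_left, treeDist_one_left] at *
  lia

/-- For a shortest `f` the translates of `y` by the vertices of the geodesic from `1` to `f` are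
distinct, because otherwise the part of the geodesic between two vertices could be cut out. -/
theorem exists_smul_eq_norm_lt {X : Type*} [MulAction (FreeGroup α) X]
    {S : Set X} (hS : S.Finite) {x y : X} (hxy : ∃ f : FreeGroup α, f • x = y)
    (hgeodesic : ∀ f : FreeGroup α, f • x = y → ∀ p, Between 1 p f → p⁻¹ • y ∈ S) :
    ∃ f : FreeGroup α, f • x = y ∧ f.norm < S.ncard := by
  let f := Function.argminOn FreeGroup.norm {f : FreeGroup α | f • x = y} hxy
  have hf : f • x = y := Function.argminOn_mem FreeGroup.norm {f : FreeGroup α | f • x = y} hxy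
  have hmin {f' : FreeGroup α} (hf' : f' • x = y) : f.norm ≤ f'.norm :=
    Function.argminOn_le FreeGroup.norm {f : FreeGroup α | f • x = y} hf'
  refine ⟨f, hf, ?_⟩
  by_contra! hcard
  let p (i : ℕ) : FreeGroup α := mk (f.toWord.take i)
  obtain ⟨i, hi, j, hj, hij, hpij⟩ :
      ∃ i ∈ Set.Iic f.norm, ∃ j ∈ Set.Iic f.norm, i ≠ j ∧ (p i)⁻¹ • y = (p j)⁻¹ • y :=
    Set.exists_ne_map_eq_of_ncard_lt_of_maps_to (by simpa using Nat.lt_succ_of_le hcard)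
      (fun i hi => hgeodesic f hf (p i) (between_one_mk_take hi)) hS
  wlog hlt : i < j generalizing i j
  · exact this j hj i hi hij.symm hpij.symm (by lia)
  have hshort := hmin (f' := p i * ((p j)⁻¹ * f)) (by
    rw [mul_smul, mul_smul, hf, ← hpij, smul_inv_smul])
  have hmul := FreeGroup.norm_mul_le (p i) ((p j)⁻¹ * f)
  have htake : (p i).norm ≤ i := norm_mk_take_le f i
  have hdrop : ((p j)⁻¹ * f).norm ≤ f.norm - j := treeDist_mk_take_le f j
  rw [Set.mem_Iic] at hj
  lia

end ShortestTranslation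

section ConjugatorLength

variable {α H : Type*} [DecidableEq α] [Group H] {φ : H →* MulAut (FreeGroup α)}

theorem injOn_ball (R : ℕ) :
    Set.InjOn (fun u : FreeGroup α ⋊[φ] H => (fun i : Fin R => u.left.toWord[i]?, u.right))
      {u | u.left.norm ≤ R} := by
  intro u hu v hv h
  obtain ⟨hword, hright⟩ := Prod.ext_iff.1 h
  refine SemidirectProduct.ext (FreeGroup.toWord_injective (List.ext_getElem? fun i => ?_)) hright
  obtain hi | hi := lt_or_ge i R
  · exact congrFun hword ⟨i, hi⟩
  · rw [List.getElem?_eq_none (hu.trans hi), List.getElem?_eq_none (hv.trans hi)]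

theorem norm_left_inl_inv_conj (v : FreeGroup α ⋊[φ] H) (p : FreeGroup α) :
    ((inl p)⁻¹ * v * inl p).left.norm = treeDist p (v • p) := by
  simp [treeDist, semidirect_smul_def, mul_assoc]

variable [Finite α]

theorem finite_ball [Finite H] (R : ℕ) : {u : FreeGroup α ⋊[φ] H | u.left.norm ≤ R}.Finite :=
  .of_injOn (Set.mapsTo_univ _ _) (injOn_ball R) Set.finite_univ

theorem ncard_ball_le [Finite H] (R : ℕ) :
    {u : FreeGroup α ⋊[φ] H | u.left.norm ≤ R}.ncard ≤
      Nat.card (Option (α × Bool)) ^ R * Nat.card H := by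
  have h := Set.ncard_le_ncard_of_injOn _ (fun _ _ => Set.mem_univ _)
    (injOn_ball (φ := φ) R) Set.finite_univ
  rwa [Set.ncard_univ, Nat.card_prod, Nat.card_fun, Nat.card_eq_fintype_card (α := Fin R),
    Fintype.card_fin] at h

theorem exists_displacement_conj_le [Fintype H] (φ : H →* MulAut (FreeGroup α)) :
    ∃ C, ∀ (u x : FreeGroup α ⋊[φ] H) (p : FreeGroup α) (R : ℕ), Between 1 p x.left →
      orbitDist φ 1 (u • 1) ≤ R → orbitDist φ 1 ((x * u * x⁻¹) • 1) ≤ R →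
        orbitDist φ p ((x * u * x⁻¹) • p) ≤ R + C := by
  obtain ⟨C, hC⟩ := exists_displacement_le φ
  refine ⟨C, fun u x p R hp hu hv => ?_⟩
  have hx : x.left = x • (1 : FreeGroup α) := by rw [semidirect_smul_def, map_one, mul_one]
  refine (hC (x * u * x⁻¹) 1 p x.left hp).trans (Nat.add_le_add_right (max_le hv ?_) C)
  rwa [hx, orbitDist_conj_smul]

theorem exists_norm_left_conjugator_lt [Fintype H] (φ : H →* MulAut (FreeGroup α)) :
    ∃ C, ∀ (u v : FreeGroup α ⋊[φ] H) (R : ℕ), orbitDist φ 1 (u • 1) ≤ R →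
      orbitDist φ 1 (v • 1) ≤ R → IsConj u v → ∃ y, y * u * y⁻¹ = v ∧
        y.left.norm < Nat.card (Option (α × Bool)) ^ (R + C) * Nat.card H := by
  obtain ⟨C, hC⟩ := exists_displacement_conj_le φ
  refine ⟨C, fun u v R hu hv huv => ?_⟩
  obtain ⟨x, hx⟩ := isConj_iff.1 huv
  let t : FreeGroup α ⋊[φ] H := inr x.right
  have left_mul_t (f : FreeGroup α) : (inl f * t).left = f := by simp [t]
  let _ : MulAction (FreeGroup α) (FreeGroup α ⋊[φ] H) :=
    .compHom _ (MulAut.conj.comp (inl : FreeGroup α →* FreeGroup α ⋊[φ] H))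
  have smul_def (f : FreeGroup α) (w : FreeGroup α ⋊[φ] H) : f • w = inl f * w * (inl f)⁻¹ := rfl
  have smul_conj (f : FreeGroup α) :
      f • (t * u * t⁻¹) = (inl f * t) * u * (inl f * t)⁻¹ := by
    rw [smul_def]; group
  have hconj : ∃ f : FreeGroup α, f • (t * u * t⁻¹) = v :=
    ⟨x.left, by rw [smul_conj, SemidirectProduct.inl_left_mul_inr_right, hx]⟩
  obtain ⟨f, hf, hnorm⟩ := exists_smul_eq_norm_lt (finite_ball (R + C)) hconj fun f hf p hp => by
    have hdisp := hC u (inl f * t) p R (by rwa [left_mul_t]) hu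
    rw [← smul_conj, hf] at hdisp
    rw [Set.mem_ofPred_eq, smul_def, map_inv, inv_inv, norm_left_inl_inv_conj]
    exact (treeDist_le_orbitDist p (v • p)).trans (hdisp hv)
  exact ⟨inl f * t, by rw [← smul_conj, hf],
    by simpa only [left_mul_t] using hnorm.trans_le (ncard_ball_le (R + C))⟩

theorem exists_wordLength_le [Finite H] {k : ℕ} {g : Fin k → FreeGroup α ⋊[φ] H}
    (hg : Subgroup.closure (Set.range g) = ⊤) :
    ∃ K L, ∀ y, wordLength g y ≤ K * y.left.norm + L := by
  obtain ⟨K, hK⟩ := exists_length_map_le inl (wordLength_one g) (wordLength_mul_le hg)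
  obtain ⟨L, hL⟩ := (Set.finite_range fun t : H => wordLength g (inr t)).bddAbove
  refine ⟨K, L, fun y => ?_⟩
  rw [← SemidirectProduct.inl_left_mul_inr_right y]
  refine (wordLength_mul_le hg _ _).trans (add_le_add ?_ (hL ⟨y.right, rfl⟩))
  simpa using hK y.left

end ConjugatorLength

theorem exists_primrec_isConjugatorLengthBound {α H : Type*} [Finite α] [Group H] [Finite H]
    {φ : H →* MulAut (FreeGroup α)} {k : ℕ} {g : Fin k → FreeGroup α ⋊[φ] H}
    (hg : Subgroup.closure (Set.range g) = ⊤) :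
    ∃ b, Primrec b ∧ IsConjugatorLengthBound g b := by
  classical
  cases nonempty_fintype H
  obtain ⟨A, hA⟩ := exists_displacement_wordValue_le g
  obtain ⟨C, hC⟩ := exists_norm_left_conjugator_lt φ
  obtain ⟨K, L, hKL⟩ := exists_wordLength_le hg
  refine ⟨fun l => K * (Nat.card (Option (α × Bool)) ^ (A * l + C) * Nat.card H) + L, ?_,
    fun w w' h => ?_⟩
  · have primrec_pow : Primrec₂ fun a n : ℕ => a ^ n := Primrec₂.unpaired'.1 Nat.Primrec.pow
    exact Primrec.nat_add.comp (Primrec.nat_mul.comp (.const K) (Primrec.nat_mul.comp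
      (primrec_pow.comp (.const _) (Primrec.nat_add.comp (Primrec.nat_mul.comp (.const A) .id)
        (.const C))) (.const _))) (.const L)
  · obtain ⟨y, hy, hnorm⟩ := hC _ _ (A * (w.length + w'.length))
      ((hA w).trans (Nat.mul_le_mul_left A (Nat.le_add_right _ _)))
      ((hA w').trans (Nat.mul_le_mul_left A (Nat.le_add_left _ _))) h
    obtain ⟨x, rfl, hx⟩ := exists_length_eq_wordLength hg y
    refine ⟨x, ?_, mul_inv_eq_iff_eq_mul.1 hy⟩
    rw [hx]
    exact (hKL _).trans (Nat.add_le_add_right (Nat.mul_le_mul_left K hnorm.le) L)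

section Search

/-- The list of the words over the alphabet `letters` of length at most `l`, with repetitions. -/
def wordsUpTo {β : Type*} (letters : List β) (l : ℕ) : List (List β) :=
  Nat.rec [[]] (fun _ W => W ++ W.flatMap fun w => letters.map fun c => c :: w) l

theorem mem_wordsUpTo {β : Type*} {letters : List β} (h : ∀ c, c ∈ letters) (w : List β) {l : ℕ}
    (hw : w.length ≤ l) : w ∈ wordsUpTo letters l := by
  induction l generalizing w with
  | zero =>
    rw [List.eq_nil_of_length_eq_zero (Nat.le_zero.1 hw)]
    exact List.mem_singleton.2 rfl
  | succ l ih =>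
    refine List.mem_append.2 ?_
    cases w with
    | nil => exact Or.inl (ih [] (Nat.zero_le _))
    | cons c w =>
      exact Or.inr (List.mem_flatMap.2
        ⟨w, ih w (Nat.le_of_succ_le_succ hw), List.mem_map.2 ⟨c, h c, rfl⟩⟩)

theorem primrec_wordsUpTo {β : Type*} [Primcodable β] (letters : List β) :
    Primrec (wordsUpTo letters) := by
  refine Primrec.nat_rec₁ _ (Primrec.list_append.comp .snd (Primrec.list_flatMap .snd ?_))
  exact Primrec.list_map (.const letters) (Primrec.list_cons.comp .snd (Primrec.snd.comp .fst))

theorem decidesConjugacy_of_isConjugatorLengthBound {G : Type*} [Group G] {k : ℕ} {g : Fin k → G}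
    {b : ℕ → ℕ} (hword : PrimrecRel fun w w' => wordValue g w = wordValue g w') (hb : Primrec b)
    (hbound : IsConjugatorLengthBound g b) : DecidesConjugacy g := by
  let letters : List (Fin k × Bool) := Finset.univ.toList
  have hletters (c : Fin k × Bool) : c ∈ letters := by simp [letters]
  have hsemiconj : PrimrecRel fun (x : List (Fin k × Bool))
      (p : List (Fin k × Bool) × List (Fin k × Bool)) =>
      wordValue g (x ++ p.1) = wordValue g (p.2 ++ x) :=
    hword.comp (Primrec.list_append.comp .fst (Primrec.fst.comp .snd))
      (Primrec.list_append.comp (Primrec.snd.comp .snd) .fst)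
  have hcandidates : Primrec fun p : List (Fin k × Bool) × List (Fin k × Bool) =>
      wordsUpTo letters (b (p.1.length + p.2.length)) :=
    (primrec_wordsUpTo letters).comp (hb.comp (Primrec.nat_add.comp
      (Primrec.list_length.comp .fst) (Primrec.list_length.comp .snd)))
  refine ((hsemiconj.exists_mem_list.comp hcandidates .id).of_eq fun p => ?_).computablePred
  simp only [wordValue_append, id]
  constructor
  · rintro ⟨x, -, hx⟩
    exact isConj_iff.2 ⟨wordValue g x, mul_inv_eq_of_eq_mul hx⟩
  · intro h
    obtain ⟨x, hxl, hx⟩ := hbound p.1 p.2 h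
    exact ⟨x, mem_wordsUpTo hletters x hxl, hx⟩

end Search

section WordProblem

theorem primrec_reduce {α : Type*} [DecidableEq α] [Primcodable α] :
    Primrec (FreeGroup.reduce : List (α × Bool) → List (α × Bool)) := by
  let push (c : α × Bool) (w : List (α × Bool)) : List (α × Bool) :=
    w.casesOn [c] fun d tail => if c.1 = d.1 ∧ c.2 = !d.2 then tail else c :: d :: tail
  have hsingleton : Primrec fun p : (α × Bool) × List (α × Bool) => [p.1] :=
    Primrec.list_cons.comp .fst (.const [])
  have hcancel : Primrec₂ fun (p q : (α × Bool) × List (α × Bool)) =>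
      if p.1.1 = q.1.1 ∧ p.1.2 = !q.1.2 then q.2 else p.1 :: q.1 :: q.2 := by
    refine Primrec.ite (.and ?_ ?_) (Primrec.snd.comp .snd) (Primrec.list_cons.comp
      (Primrec.fst.comp .fst) (Primrec.list_cons.comp (Primrec.fst.comp .snd)
        (Primrec.snd.comp .snd)))
    · exact Primrec.eq.comp (Primrec.fst.comp (Primrec.fst.comp .fst))
        (Primrec.fst.comp (Primrec.fst.comp .snd))
    · exact Primrec.eq.comp (Primrec.snd.comp (Primrec.fst.comp .fst))
        (Primrec.not.comp (Primrec.snd.comp (Primrec.fst.comp .snd)))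
  have hpush : Primrec₂ push := Primrec.list_casesOn .snd hsingleton hcancel
  refine (Primrec.list_foldr .id (.const []) (hpush.comp₂ (Primrec.fst.comp₂ .right)
    (Primrec.snd.comp₂ .right))).of_eq fun w => ?_
  induction w with
  | nil => rfl
  | cons c w ih => rw [FreeGroup.reduce.cons, ← ih]; rfl

theorem toWord_map_mk {α β : Type*} [DecidableEq β] (f : FreeGroup α →* FreeGroup β)
    (w : List (α × Bool)) :
    (f (mk w)).toWord = FreeGroup.reduce (w.flatMap fun d => (f (mk [d])).toWord) := by
  rw [← FreeGroup.toWord_mk]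
  congr 1
  induction w with
  | nil => exact map_one f
  | cons d w ih =>
    rw [map_mk_cons, ih, List.flatMap_cons, ← FreeGroup.mul_mk, FreeGroup.mk_toWord]

variable {ι α H : Type*} [DecidableEq α] [Finite α] [Primcodable α]

theorem primrec_toWord_map_mk [Finite ι] [Primcodable ι] (ψ : ι → MulAut (FreeGroup α)) :
    Primrec₂ fun i w => (ψ i (mk w)).toWord := by
  have hletter : Primrec₂ fun (p : ι × List (α × Bool)) d => (ψ p.1 (mk [d])).toWord :=
    (Primrec.dom_finite fun p : ι × α × Bool => (ψ p.1 (mk [p.2])).toWord).comp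
      (.pair (Primrec.fst.comp .fst) .snd)
  exact (primrec_reduce.comp (Primrec.list_flatMap .snd hletter)).of_eq fun p =>
    (toWord_map_mk (ψ p.1).toMonoidHom p.2).symm

variable [Group H] [Finite H] [Primcodable H] {φ : H →* MulAut (FreeGroup α)}

theorem primrec_normalForm_wordValue {k : ℕ} (g : Fin k → FreeGroup α ⋊[φ] H) :
    Primrec fun w => ((wordValue g w).left.toWord, (wordValue g w).right) := by
  let letter (c : Fin k × Bool) : FreeGroup α ⋊[φ] H := wordValue g [c]
  let mulLetter (c : Fin k × Bool) (s : List (α × Bool) × H) : List (α × Bool) × H :=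
    (FreeGroup.reduce ((letter c).left.toWord ++ (φ (letter c).right (mk s.1)).toWord),
      (letter c).right * s.2)
  have primrec_mulLetter : Primrec₂ mulLetter := by
    refine Primrec.pair (primrec_reduce.comp (Primrec.list_append.comp ?_ ?_)) ?_
    · exact (Primrec.dom_finite fun c => (letter c).left.toWord).comp .fst
    · exact (primrec_toWord_map_mk fun c => φ (letter c).right).comp .fst
        (Primrec.fst.comp .snd)
    · exact (Primrec.dom_finite fun p : (Fin k × Bool) × H => (letter p.1).right * p.2).comp
        (.pair .fst (Primrec.snd.comp .snd))
  refine (Primrec.list_foldr .id (.const ([], 1)) (primrec_mulLetter.comp₂ (Primrec.fst.comp₂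
    .right) (Primrec.snd.comp₂ .right))).of_eq fun w => ?_
  induction w with
  | nil => rfl
  | cons c w ih =>
    have hcons : wordValue g (c :: w) = letter c * wordValue g w := wordValue_append g [c] w
    rw [id, List.foldr_cons] at *
    rw [ih, hcons]
    simp only [mulLetter, FreeGroup.mk_toWord, SemidirectProduct.mul_left,
      SemidirectProduct.mul_right, FreeGroup.toWord_mul]

end WordProblem

theorem primrecRel_wordValue_eq {α H : Type*} [Finite α] [Primcodable α] [Group H] [Finite H]
    [Primcodable H] {φ : H →* MulAut (FreeGroup α)} {k : ℕ} (g : Fin k → FreeGroup α ⋊[φ] H) :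
    PrimrecRel fun w w' => wordValue g w = wordValue g w' := by
  classical
  refine (Primrec.eq.comp ((primrec_normalForm_wordValue g).comp .fst)
    ((primrec_normalForm_wordValue g).comp .snd)).of_eq fun p => ?_
  rw [Prod.mk.injEq, FreeGroup.toWord_inj, ← SemidirectProduct.ext_iff]

theorem semidirectProduct_fg {N H : Type*} [Group N] [Group H] [Group.FG N] [Group.FG H]
    (φ : H →* MulAut N) : Group.FG (N ⋊[φ] H) := by
  have htop : (⊤ : Subgroup (N ⋊[φ] H)) =
      (inl : N →* N ⋊[φ] H).range ⊔ (inr : H →* N ⋊[φ] H).range := by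
    refine (eq_top_iff.2 fun u _ => ?_).symm
    rw [← SemidirectProduct.inl_left_mul_inr_right u]
    exact Subgroup.mul_mem_sup ⟨u.left, rfl⟩ ⟨u.right, rfl⟩
  rw [Group.fg_def, htop]
  exact ((Group.fg_iff_subgroup_fg _).1 (Group.fg_range _)).sup
    ((Group.fg_iff_subgroup_fg _).1 (Group.fg_range _))

theorem proposition4p1_general {α H : Type*} [Finite α] [Group H] [Finite H]
    (φ : H →* MulAut (FreeGroup α)) : ConjugacyProblemSolvable (FreeGroup α ⋊[φ] H) := by
  refine ⟨semidirectProduct_fg φ, fun k g hg => ?_⟩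
  classical
  let _ : Primcodable α := .ofEquiv _ (Finite.equivFin α)
  let _ : Primcodable H := .ofEquiv _ (Finite.equivFin H)
  obtain ⟨b, hb, hbound⟩ := exists_primrec_isConjugatorLengthBound hg
  exact decidesConjugacy_of_isConjugatorLengthBound (primrecRel_wordValue_eq g) hb hbound

theorem proposition4p1 (n : ℕ) (M : Subgroup (MulAut (FreeGroup (Fin n)))) [Finite M] :
    ConjugacyProblemSolvable (FreeGroup (Fin n) ⋊[M.subtype] M) :=
  proposition4p1_general M.subtype
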